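/- **Setting.** Let $G$ be a Lie group with Lie algebra $\mathfrak g$ acting smoothly on a smooth manifold $M$ without boundary (both finite-dimensional or, more generally, modelled on Banach spaces). For $\xi\in\mathfrak g$ let $\xi_M(m)=\frac{d}{dt}\big|_{0}\exp(t\xi)\cdot m$ be the infinitesimal generator, $\tilde{\mathfrak g}|_m=\{\xi_M(m):\xi\in\mathfrak g\}$ the tangent space of the orbit, $G_m$ the isotropy group and $\mathfrak g_m=\{\xi\in\mathfrak g:\xi_M(m)=0\}$ the isotropy algebra. A *dual connection form* is a smooth $\mathfrak g^*$-valued one-form $\mu$ on $M$ which is equivariant, $\mu_{g\cdot m}(d_m\Phi_g v)=\mu_m(v)\circ \mathrm{Ad}_{g^{-1}}$ (where $\Phi_g(m)=g\cdot m$), and satisfies $T_mM=\tilde{\mathfrak g}|_m\oplus\ker\mu_m$ for all $m$. Put $\Gamma=\ker\mu$, let $\mathbb P_\Gamma$ be the projection of $TM$ onto $\Gamma$ along $\tilde{\mathfrak g}$, let $\chi(m)\xi=\mu_m(\xi_M(m))$, and $\nabla\mu(u,v)=d\mu(\mathbb P_\Gamma u,\mathbb P_\Gamma v)$, with the convention $d\mu(X,Y)=X(\mu(Y))-Y(\mu(X))-\mu([X,Y])$.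 The form $\mu$ is *docile at $m$* if $\nabla\mu(u,v)\in\operatorname{range}\mu_m$ for all $u,v\in T_mM$; its *curvature* at $m$ is then $\Omega_m(u,v)=\xi_M(m)$ for any $\xi\in\mathfrak g$ with $\chi(m)\xi=\nabla\mu(u,v)$. An *adaptor* for $m_0\in M$ is a smooth map $\phi:\mathcal U\to G$ on a $G_{m_0}$-invariant open neighborhood $\mathcal U$ of $m_0$ with $\phi(g\cdot m)=g\,\phi(m)\,g^{-1}$ and $\mathfrak g_m\subseteq \mathrm{Ad}_{\phi(m)}\mathfrak g_{m_0}$ for $m\in\mathcal U$, $g\in G_{m_0}$, and $\phi(m_0)\in G_{m_0}$. The *almost horizontal system* on $\mathcal U$ is $$\Xi|_m=\Gamma|_m\oplus\{(\mathrm{Ad}_{\phi(m)}\zeta)_M(m):\zeta\in\mathfrak g_{m_0}\},$$ and a smooth vector field on an open subset of $\mathcal U$ is *almost horizontal* if its values lie in $\Xi$. Let $d^L_m\phi=d_m(\phi(m)^{-1}\phi(\cdot)):T_mM\to\mathfrak g$. **Standing assumption.** There are a $G_{m_0}$-equivariant (continuous linear) projection $\pi$ of $\mathfrak g$ with $\ker\pi=\mathfrak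 g_{m_0}$ and a differentiable map $\iota:\mathcal U\to L(\mathfrak g^*,\mathfrak g)$ such that $\pi=\pi\circ\iota(m)\circ\chi(m)\circ\mathrm{Ad}_{\phi(m)}$ for all $m\in\mathcal U$. **Theorem.** Let $\mu$ be a dual connection form, $m_0\in M$ (in particular $m_0$ may be a singular point), and $\phi:\mathcal U\to G$ an adaptor for $m_0$ satisfying the standing assumption. 1. Let $m\in\mathcal U$ be such that $\mu$ is docile at $m$ and $$[d^L_m\phi(\Xi|_m),\mathfrak g_{m_0}]\subseteq\mathfrak g_{m_0}.\qquad(*)$$ Then for all almost horizontal vector fields $X,Y$ on an open neighborhood of $m$ in $\mathcal U$, $\ \Omega_m(X(m),Y(m))+[X,Y](m)\in\Xi|_m$. 2. Let $\mathcal V\subseteq\mathcal U$ be an open neighborhood of $m_0$ such that $\mu$ is docile at every point of $\mathcal V$, $(*)$ holds at every $m\in\mathcal V$, and $\Omega_m(u,v)\in\Xi|_m$ for all $m\in\mathcal V$ and $u,v\in T_mM$. Then $\Xi$ is involutive on $\mathcal V$: if $X,Y$ are almost horizontal vector fields on an open set $W\subseteq\mathcal V$, then so is $[X,Y]$. -/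

import Mathlib

open scoped Manifold ContDiff

noncomputable section

namespace PartialConn

/-! Throughout, `G` is a Lie group modelled on the space `EG` and `M` is a manifold modelled on the
space `E`. The Lie algebra `𝔤` of `G` is `GroupLieAlgebra 𝓘(ℝ, EG) G`, the tangent space `T_1 G`,
with the bracket of left-invariant vector fields. In Mathlib the vector space underlying `T_1 G` is
by definition `EG`, so `EG` is written for `𝔤` and `EG →L[ℝ] ℝ` for the dual `𝔤*` wherever a norm
is needed. -/

variable {E : Type*} [NormedAddCommGroup E] [NormedSpace ℝ E]
  {EG : Type*} [NormedAddCommGroup EG] [NormedSpace ℝ EG]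
  {G : Type*} [TopologicalSpace G] [ChartedSpace EG G] [Group G]
  {M : Type*} [TopologicalSpace M] [ChartedSpace E M] [MulAction G M]

/-- The adjoint representation: `Ad g : 𝔤 → 𝔤` is the derivative at `1` of `h ↦ g h g⁻¹`. -/
def Ad (g : G) : EG →L[ℝ] EG :=
  mfderiv 𝓘(ℝ, EG) 𝓘(ℝ, EG) (fun h : G => g * h * g⁻¹) 1

/-- The Lie bracket of the Lie algebra of `G`. -/
def lieBracket (G : Type*) [TopologicalSpace G] [ChartedSpace EG G] [Group G]
    (ξ η : GroupLieAlgebra 𝓘(ℝ, EG) G) : GroupLieAlgebra 𝓘(ℝ, EG) G :=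
  ⁅ξ, η⁆

/-- The infinitesimal generator map `ξ ↦ ξ_M(m)`: the derivative at `1` of `g ↦ g • m`. -/
def infGen (G : Type*) [TopologicalSpace G] [ChartedSpace EG G] [Group G] [MulAction G M] (m : M) :
    EG →L[ℝ] TangentSpace 𝓘(ℝ, E) m :=
  mfderiv 𝓘(ℝ, EG) 𝓘(ℝ, E) (fun g : G => g • m) 1

/-- The tangent space at `m` of the group orbit through `m`: the vectors `ξ_M(m)`. -/
def orbitTangent (G : Type*) [TopologicalSpace G] [ChartedSpace EG G] [Group G] [MulAction G M]
    (m : M) : Submodule ℝ (TangentSpace 𝓘(ℝ, E) m) :=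
  LinearMap.range (infGen (E := E) (EG := EG) G m).toLinearMap

/-- The isotropy algebra `𝔤_m = {ξ ∈ 𝔤 | ξ_M(m) = 0}`. -/
def isotropyAlg (E : Type*) [NormedAddCommGroup E] [NormedSpace ℝ E]
    (G : Type*) [TopologicalSpace G] [ChartedSpace EG G] [Group G]
    {M : Type*} [TopologicalSpace M] [ChartedSpace E M] [MulAction G M]
    (m : M) : Submodule ℝ EG :=
  LinearMap.ker (infGen (E := E) (EG := EG) G m).toLinearMap

/-- The exterior derivative at `m` of a one-form `θ` on `M` with values in a normed space: transport
`θ` to the model space by the preferred chart at `m`, and take the exterior derivative there. It is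
normalized by `dθ(X, Y) = X (θ Y) - Y (θ X) - θ [X, Y]`. -/
def extDerivOneForm {F : Type*} [NormedAddCommGroup F] [NormedSpace ℝ F]
    (θ : ∀ m : M, TangentSpace 𝓘(ℝ, E) m →L[ℝ] F) (m : M) (u v : TangentSpace 𝓘(ℝ, E) m) : F :=
  extDeriv
    (fun y : E => ContinuousAlternatingMap.ofSubsingleton ℝ E F (0 : Fin 1)
      ((θ ((extChartAt 𝓘(ℝ, E) m).symm y)).comp
        (mfderiv 𝓘(ℝ, E) 𝓘(ℝ, E) (extChartAt 𝓘(ℝ, E) m).symm y)))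
    (extChartAt 𝓘(ℝ, E) m m)
    ![(mfderiv 𝓘(ℝ, E) 𝓘(ℝ, E) (extChartAt 𝓘(ℝ, E) m) m u : E),
      (mfderiv 𝓘(ℝ, E) 𝓘(ℝ, E) (extChartAt 𝓘(ℝ, E) m) m v : E)]

variable (E EG G M) in
/-- An (equivariant) dual connection form: a smooth one-form `μ` on `M` with values in `𝔤*`,
equivariant for the coadjoint action, such that `T_m M` is the direct sum of the tangent space to
the group orbit and of `ker μ_m`, for every `m`. -/
structure DualConnectionForm [IsManifold 𝓘(ℝ, E) ∞ M] where
  /-- The one-form. -/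
  toForm : ∀ m : M, TangentSpace 𝓘(ℝ, E) m →L[ℝ] (EG →L[ℝ] ℝ)
  smooth : ContMDiff 𝓘(ℝ, E) (𝓘(ℝ, E).prod 𝓘(ℝ, E →L[ℝ] (EG →L[ℝ] ℝ))) ∞
    (fun m => Bundle.TotalSpace.mk' (E →L[ℝ] (EG →L[ℝ] ℝ))
      (E := fun m : M => TangentSpace 𝓘(ℝ, E) m →L[ℝ] Bundle.Trivial M (EG →L[ℝ] ℝ) m)
      m (toForm m))
  equivariant : ∀ (g : G) (m : M) (v : TangentSpace 𝓘(ℝ, E) m),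
    toForm (g • m) (mfderiv 𝓘(ℝ, E) 𝓘(ℝ, E) (fun x : M => g • x) m v)
      = (toForm m v).comp (Ad g⁻¹)
  isCompl : ∀ m : M, IsCompl (orbitTangent (EG := EG) G m) (LinearMap.ker (toForm m).toLinearMap)

namespace DualConnectionForm

variable [IsManifold 𝓘(ℝ, E) ∞ M] (μ : DualConnectionForm E EG G M)

/-- The partial connection `Γ = ker μ`. -/
def horizontal (m : M) : Submodule ℝ (TangentSpace 𝓘(ℝ, E) m) :=
  LinearMap.ker (μ.toForm m).toLinearMap

/-- The inertia factor `χ(m) = μ_m ∘ (ξ ↦ ξ_M(m)) : 𝔤 → 𝔤*`. -/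
def inertia (m : M) : EG →L[ℝ] (EG →L[ℝ] ℝ) :=
  (μ.toForm m).comp (infGen G m)

/-- The projection of `T_m M` onto `Γ_m` along the tangent space to the group orbit. -/
def horProj (m : M) : TangentSpace 𝓘(ℝ, E) m →ₗ[ℝ] TangentSpace 𝓘(ℝ, E) m :=
  (μ.horizontal m).projection (orbitTangent (EG := EG) G m) (μ.isCompl m).symm

/-- The covariant derivative `∇μ(u, v) = dμ(P_Γ u, P_Γ v)`. -/
def covDeriv (m : M) (u v : TangentSpace 𝓘(ℝ, E) m) : EG →L[ℝ] ℝ :=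
  extDerivOneForm μ.toForm m (μ.horProj m u) (μ.horProj m v)

/-- `μ` is docile at `m` if `∇μ` takes its values at `m` in the range of `μ_m`. -/
def DocileAt (m : M) : Prop :=
  ∀ u v : TangentSpace 𝓘(ℝ, E) m,
    μ.covDeriv m u v ∈ LinearMap.range (μ.toForm m).toLinearMap

open Classical in
/-- The map `γ(m)` from the range of `χ(m)` to the tangent space of the orbit:
`γ(m) ν = ξ_M(m)` for any `ξ` with `χ(m) ξ = ν`. Outside the range of `χ(m)` the value is `0`. -/
def gamma (m : M) (ν : EG →L[ℝ] ℝ) : TangentSpace 𝓘(ℝ, E) m :=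
  if h : ∃ ξ : EG, μ.inertia m ξ = ν then infGen G m h.choose else 0

/-- `γ(m)` does not depend on the choice of `ξ`. -/
theorem gamma_inertia (m : M) (ξ : EG) : μ.gamma m (μ.inertia m ξ) = infGen G m ξ := by
  have h : ∃ ζ : EG, μ.inertia m ζ = μ.inertia m ξ := ⟨ξ, rfl⟩
  rw [gamma, dif_pos h]
  have hs : μ.toForm m (infGen G m h.choose - infGen G m ξ) = 0 := by
    rw [map_sub, sub_eq_zero]
    exact h.choose_spec
  exact sub_eq_zero.mp <| Submodule.disjoint_def.mp (μ.isCompl m).disjoint _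
    (Submodule.sub_mem _ ⟨_, rfl⟩ ⟨_, rfl⟩) hs

/-- The curvature `Ω_m = γ(m) ∘ ∇μ_m`, to be used at points where `μ` is docile. -/
def curvature (m : M) (u v : TangentSpace 𝓘(ℝ, E) m) : TangentSpace 𝓘(ℝ, E) m :=
  μ.gamma m (μ.covDeriv m u v)

end DualConnectionForm

variable (E EG G) in
/-- An adaptor for `m₀`: a smooth map `φ : U → G`, on a `G_{m₀}`-invariant open neighborhood `U` of
`m₀`, which is `G_{m₀}`-equivariant with respect to conjugation in `G`, and satisfies
`𝔤_m ⊆ Ad_{φ(m)} 𝔤_{m₀}` for `m ∈ U` and `φ(m₀) ∈ G_{m₀}`. -/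
structure Adaptor (m₀ : M) where
  /-- The map `φ`; only its values on `domain` matter. -/
  toFun : M → G
  /-- The domain `U`. -/
  domain : Set M
  isOpen_domain : IsOpen domain
  mem_domain : m₀ ∈ domain
  smul_mem : ∀ g ∈ MulAction.stabilizer G m₀, ∀ m ∈ domain, g • m ∈ domain
  smooth : ContMDiffOn 𝓘(ℝ, E) 𝓘(ℝ, EG) ∞ toFun domain
  equivariant : ∀ g ∈ MulAction.stabilizer G m₀, ∀ m ∈ domain, toFun (g • m) = g * toFun m * g⁻¹
  isotropy_le : ∀ m ∈ domain, isotropyAlg (EG := EG) E G m ≤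
    (isotropyAlg (EG := EG) E G m₀).map (Ad (EG := EG) (toFun m)).toLinearMap
  map_base : toFun m₀ ∈ MulAction.stabilizer G m₀

namespace Adaptor

variable {m₀ : M} (φ : Adaptor E EG G m₀)

/-- The left trivialization of the derivative of `φ` at `m`: the derivative at `m` of
`x ↦ φ(m)⁻¹ φ(x)`, with values in `T_1 G = 𝔤`. -/
def leftDeriv (m : M) : TangentSpace 𝓘(ℝ, E) m →L[ℝ] EG :=
  mfderiv 𝓘(ℝ, E) 𝓘(ℝ, EG) (fun x : M => (φ.toFun m)⁻¹ * φ.toFun x) m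

variable [IsManifold 𝓘(ℝ, E) ∞ M] (μ : DualConnectionForm E EG G M)

/-- The almost horizontal system: `Ξ_m` is the sum of `Γ_m` and of
`{(Ad_{φ(m)} ζ)_M(m) | ζ ∈ 𝔤_{m₀}}`. The sum is direct, since the second space lies in the tangent
space to the group orbit. -/
def almostHorizontal (m : M) : Submodule ℝ (TangentSpace 𝓘(ℝ, E) m) :=
  μ.horizontal m ⊔
    ((isotropyAlg (EG := EG) E G m₀).map (Ad (EG := EG) (φ.toFun m)).toLinearMap).map
      (infGen (E := E) (EG := EG) G m).toLinearMap

/-- The condition `[d^L φ(Ξ_m), 𝔤_{m₀}] ⊆ 𝔤_{m₀}` at the point `m`. -/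
def BracketCondition (m : M) : Prop :=
  ∀ w ∈ φ.almostHorizontal μ m, ∀ ζ ∈ isotropyAlg (EG := EG) E G m₀,
    lieBracket G (φ.leftDeriv m w) ζ ∈ isotropyAlg (EG := EG) E G m₀

/-- The adapted inertia factor `χ_φ(m) = χ(m) ∘ Ad_{φ(m)}`. -/
def adaptedInertia (m : M) : EG →L[ℝ] (EG →L[ℝ] ℝ) :=
  (μ.inertia m).comp (Ad (φ.toFun m))

/-- `ι : U → L(𝔤*, 𝔤)` is a differentiable restricted pseudo-inverse of `χ_φ`, relative to the
projection `π` of `𝔤`: `π = π ∘ ι(m) ∘ χ_φ(m)` on the domain `U` of `φ`. -/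
structure IsRestrictedPseudoInverse (π : EG →L[ℝ] EG) (ι : M → (EG →L[ℝ] ℝ) →L[ℝ] EG) :
    Prop where
  differentiable : MDifferentiableOn 𝓘(ℝ, E) 𝓘(ℝ, (EG →L[ℝ] ℝ) →L[ℝ] EG) ι φ.domain
  comp_eq : ∀ m ∈ φ.domain, π = π.comp ((ι m).comp (φ.adaptedInertia μ m))

end Adaptor

/-- `π` is a `G_{m₀}`-equivariant projection on `𝔤` with kernel `𝔤_{m₀}`. -/
structure IsIsotropyProjection (E : Type*) [NormedAddCommGroup E] [NormedSpace ℝ E]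
    (G : Type*) [TopologicalSpace G] [ChartedSpace EG G] [Group G]
    {M : Type*} [TopologicalSpace M] [ChartedSpace E M] [MulAction G M]
    (m₀ : M) (π : EG →L[ℝ] EG) : Prop where
  comp_self : π.comp π = π
  ker_eq : LinearMap.ker π.toLinearMap = isotropyAlg (EG := EG) E G m₀
  equivariant : ∀ g ∈ MulAction.stabilizer G m₀,
    π.comp (Ad (EG := EG) g) = (Ad (EG := EG) g).comp π

/-- `X` is a smooth vector field on `W` with values in the system `D` of tangent subspaces. -/
structure IsSmoothSection (D : ∀ m : M, Submodule ℝ (TangentSpace 𝓘(ℝ, E) m))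
    [IsManifold 𝓘(ℝ, E) ∞ M] (X : ∀ m : M, TangentSpace 𝓘(ℝ, E) m) (W : Set M) : Prop where
  smooth : ContMDiffOn 𝓘(ℝ, E) 𝓘(ℝ, E).tangent ∞
    (fun m => (⟨m, X m⟩ : TangentBundle 𝓘(ℝ, E) M)) W
  mem : ∀ m ∈ W, X m ∈ D m

/-- The system `D` of tangent subspaces is involutive on the open set `V`: the bracket of two smooth
vector fields with values in `D`, on an open subset of `V`, has its values in `D`. -/
def InvolutiveOn (D : ∀ m : M, Submodule ℝ (TangentSpace 𝓘(ℝ, E) m))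
    [IsManifold 𝓘(ℝ, E) ∞ M] (V : Set M) : Prop :=
  ∀ W : Set M, IsOpen W → W ⊆ V → ∀ X Y : (∀ m : M, TangentSpace 𝓘(ℝ, E) m),
    IsSmoothSection D X W → IsSmoothSection D Y W →
    ∀ m ∈ W, VectorField.mlieBracket 𝓘(ℝ, E) X Y m ∈ D m

end PartialConn

end

noncomputable section

set_option linter.unusedSectionVars false

namespace PartialConn

open Filter Topology

/-! The almost horizontal system is the kernel of the one-form `α = π ∘ ι ∘ μ` on the domain of the
adaptor. Indeed `α` kills horizontal vectors, and the pseudo-inverse identity gives `α((Ad_φ ζ)_M) =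
π ζ`, which vanishes exactly when `ζ ∈ 𝔤_{m₀}` (`mem_almostHorizontal_iff`). So it suffices to show
`α(Ω(X, Y) + [X, Y]) = 0`.

If `α(X) = α(Y) = 0`, then `α([X, Y]) = -dα(X, Y)`, and `dα` contains `π ι dμ` together with a term
in the derivative of `ι`, about which nothing is known directly. That term is eliminated by
differentiating the identity `α((Ad_φ η)_M) = π η` along almost horizontal vectors; condition (*)
makes the contribution of `dφ` vanish (`deriv_comp_form_gen`).

What remains splits according to `X = h + ζ'_M`, `Y = k + η'_M`, where `h`, `k` are horizontal and
`ζ' = Ad_φ ζ`, `η' = Ad_φ η`. The horizontal part `dμ(h, k)` equals `μ(Ω(X, Y))` by docility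
(`form_curvature`). The mixed parts vanish by infinitesimal equivariance of `μ`
(`fderiv_coordForm_gen`). The vertical part is `α([ζ', η']_M) = π [ζ, η]`, zero because `𝔤_{m₀}` is
a subalgebra (`gen_ad`, `ad_Ad`, `ad_mem_isotropyAlg`).

All derivatives are taken at `m` in the preferred chart there: `N` is that of `μ`, `J` that of `ι`,
and `L` the mixed second derivative of the action. Part 2 subtracts `Ω` from part 1. -/

/-- The derivative of a map between manifolds, as a map between the model spaces. -/
def tderiv (E : Type*) [NormedAddCommGroup E] [NormedSpace ℝ E]
    (E' : Type*) [NormedAddCommGroup E'] [NormedSpace ℝ E']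
    {M : Type*} [TopologicalSpace M] [ChartedSpace E M]
    {M' : Type*} [TopologicalSpace M'] [ChartedSpace E' M'] (f : M → M') (x : M) : E →L[ℝ] E' :=
  mfderiv 𝓘(ℝ, E) 𝓘(ℝ, E') f x

/-! ### Tangent maps and preferred charts -/

section Charts

variable {E : Type*} [NormedAddCommGroup E] [NormedSpace ℝ E]
  {M : Type*} [TopologicalSpace M] [ChartedSpace E M]
  {E' : Type*} [NormedAddCommGroup E'] [NormedSpace ℝ E']
  {M' : Type*} [TopologicalSpace M'] [ChartedSpace E' M']
  {E'' : Type*} [NormedAddCommGroup E''] [NormedSpace ℝ E'']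
  {M'' : Type*} [TopologicalSpace M''] [ChartedSpace E'' M'']

theorem tderiv_comp {g : M' → M''} {f : M → M'} {x : M}
    (hg : MDifferentiableAt 𝓘(ℝ, E') 𝓘(ℝ, E'') g (f x))
    (hf : MDifferentiableAt 𝓘(ℝ, E) 𝓘(ℝ, E') f x) :
    tderiv E E'' (fun z => g (f z)) x = (tderiv E' E'' g (f x)).comp (tderiv E E' f x) :=
  mfderiv_comp x hg hf

theorem tderiv_eq_fderiv (f : E → E') (x : E) : tderiv E E' f x = fderiv ℝ f x :=
  mfderiv_eq_fderiv

theorem tderiv_congr {f g : M → M'} {x : M} (h : f =ᶠ[𝓝 x] g) : tderiv E E' f x = tderiv E E' g x :=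
  h.mfderiv_eq

theorem tderiv_id (x : M) : tderiv E E (fun z : M => z) x = ContinuousLinearMap.id ℝ E :=
  mfderiv_id

/-- Tangent spaces are trivialized by the preferred charts, so a chart is invisible to first order
at its own base point. This removes every coordinate change from formulas evaluated at that point.
-/
theorem tderiv_extChartAt_self [IsManifold 𝓘(ℝ, E) ∞ M] (m : M) :
    tderiv E E (extChartAt 𝓘(ℝ, E) m) m = ContinuousLinearMap.id ℝ E :=
  have : IsManifold 𝓘(ℝ, E) 1 M := .of_le (n := ∞) (by simp)
  mfderiv_extChartAt_self

theorem mdifferentiableAt_chart [IsManifold 𝓘(ℝ, E) ∞ M] {m x : M}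
    (h : x ∈ (extChartAt 𝓘(ℝ, E) m).source) :
    MDifferentiableAt 𝓘(ℝ, E) 𝓘(ℝ, E) (extChartAt 𝓘(ℝ, E) m) x :=
  have : IsManifold 𝓘(ℝ, E) 1 M := .of_le (n := ∞) (by simp)
  mdifferentiableAt_extChartAt (by simpa using h)

theorem mdifferentiableAt_chart_symm [IsManifold 𝓘(ℝ, E) ∞ M] {m : M} {y : E}
    (h : y ∈ (extChartAt 𝓘(ℝ, E) m).target) :
    MDifferentiableAt 𝓘(ℝ, E) 𝓘(ℝ, E) (extChartAt 𝓘(ℝ, E) m).symm y := by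
  have : IsManifold 𝓘(ℝ, E) 1 M := .of_le (n := ∞) (by simp)
  exact (mdifferentiableOn_extChartAt_symm (I := 𝓘(ℝ, E)) (x := m)).mdifferentiableAt
    ((isOpen_extChartAt_target m).mem_nhds h)

theorem eventually_mem_chart_target (m : M) :
    ∀ᶠ y in 𝓝 (extChartAt 𝓘(ℝ, E) m m), y ∈ (extChartAt 𝓘(ℝ, E) m).target :=
  extChartAt_target_mem_nhds m

theorem tendsto_chart_symm (m : M) :
    Tendsto (extChartAt 𝓘(ℝ, E) m).symm (𝓝 (extChartAt 𝓘(ℝ, E) m m)) (𝓝 m) := by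
  have := continuousAt_extChartAt_symm (I := 𝓘(ℝ, E)) m
  rwa [ContinuousAt, extChartAt_to_inv] at this

theorem tderiv_symm_comp_chart [IsManifold 𝓘(ℝ, E) ∞ M] {m x : M}
    (h : x ∈ (extChartAt 𝓘(ℝ, E) m).source) :
    (tderiv E E (extChartAt 𝓘(ℝ, E) m).symm (extChartAt 𝓘(ℝ, E) m x)).comp
      (tderiv E E (extChartAt 𝓘(ℝ, E) m) x) = ContinuousLinearMap.id ℝ E := by
  rw [← tderiv_comp (mdifferentiableAt_chart_symm ((extChartAt 𝓘(ℝ, E) m).map_source h))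
    (mdifferentiableAt_chart h), ← tderiv_id x]
  apply tderiv_congr
  filter_upwards [(isOpen_extChartAt_source m).mem_nhds h] with z hz
  exact (extChartAt 𝓘(ℝ, E) m).left_inv hz

theorem tderiv_chart_symm_self [IsManifold 𝓘(ℝ, E) ∞ M] (m : M) :
    tderiv E E (extChartAt 𝓘(ℝ, E) m).symm (extChartAt 𝓘(ℝ, E) m m) =
      ContinuousLinearMap.id ℝ E := by
  have h := tderiv_symm_comp_chart (mem_extChartAt_source (I := 𝓘(ℝ, E)) m)
  rwa [tderiv_extChartAt_self, ContinuousLinearMap.comp_id] at h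

end Charts

/-! ### Symmetry of mixed second derivatives -/

section Mixed

variable {P E F : Type*} [NormedAddCommGroup P] [NormedSpace ℝ P]
  [NormedAddCommGroup E] [NormedSpace ℝ E] [NormedAddCommGroup F] [NormedSpace ℝ F]

/-- The mixed second derivatives of a `C²` map of two variables agree. -/
theorem exists_mixed_deriv {f : P × E → F} {k : P} {y : E} (hf : ContDiffAt ℝ ∞ f (k, y)) :
    ∃ L : P →L[ℝ] E →L[ℝ] F,
      HasFDerivAt (fun k' => fderiv ℝ (fun y' => f (k', y')) y) L k ∧
      HasFDerivAt (fun y' => fderiv ℝ (fun k' => f (k', y')) k) L.flip y := by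
  have hev : ∀ᶠ z in 𝓝 (k, y), DifferentiableAt ℝ f z := by
    filter_upwards [(hf.of_le (m := 1) (by simp)).eventually (by simp)] with z hz
    exact hz.differentiableAt (by simp)
  have hd : DifferentiableAt ℝ (fderiv ℝ f) (k, y) :=
    (hf.fderiv_right (m := 1) (by norm_cast)).differentiableAt (by simp)
  have hsymm : IsSymmSndFDerivAt ℝ f (k, y) := hf.isSymmSndFDerivAt (by simp; norm_cast)
  have c1 : HasFDerivAt (fun k' : P => (k', y)) (ContinuousLinearMap.inl ℝ P E) k :=
    hasFDerivAt_prodMk_left k y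
  have c2 : HasFDerivAt (fun y' : E => (k, y')) (ContinuousLinearMap.inr ℝ P E) y :=
    hasFDerivAt_prodMk_right k y
  let L1 : P →L[ℝ] E →L[ℝ] F :=
    ((ContinuousLinearMap.compL ℝ E (P × E) F).flip (ContinuousLinearMap.inr ℝ P E)).comp
      ((fderiv ℝ (fderiv ℝ f) (k, y)).comp (ContinuousLinearMap.inl ℝ P E))
  let L2 : E →L[ℝ] P →L[ℝ] F :=
    ((ContinuousLinearMap.compL ℝ P (P × E) F).flip (ContinuousLinearMap.inl ℝ P E)).comp
      ((fderiv ℝ (fderiv ℝ f) (k, y)).comp (ContinuousLinearMap.inr ℝ P E))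
  have h1 : HasFDerivAt (fun k' => fderiv ℝ (fun y' => f (k', y')) y) L1 k := by
    have h := ((ContinuousLinearMap.compL ℝ E (P × E) F).flip
      (ContinuousLinearMap.inr ℝ P E)).hasFDerivAt.comp k
      (hd.hasFDerivAt.comp k c1)
    refine h.congr_of_eventuallyEq ?_
    filter_upwards [c1.continuousAt.eventually hev] with k' hk'
    exact (hk'.hasFDerivAt.comp y (hasFDerivAt_prodMk_right k' y)).fderiv
  have h2 : HasFDerivAt (fun y' => fderiv ℝ (fun k' => f (k', y')) k) L2 y := by
    have h := ((ContinuousLinearMap.compL ℝ P (P × E) F).flip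
      (ContinuousLinearMap.inl ℝ P E)).hasFDerivAt.comp y
      (hd.hasFDerivAt.comp y c2)
    refine h.congr_of_eventuallyEq ?_
    filter_upwards [c2.continuousAt.eventually hev] with y' hy'
    exact (hy'.hasFDerivAt.comp k (hasFDerivAt_prodMk_left k y')).fderiv
  refine ⟨L1, h1, ?_⟩
  -- The two iterated derivatives are restrictions of the same second derivative to the two factors,
  -- and its symmetry gives `L1.flip = L2`.
  convert h2 using 1
  ext v ζ
  exact hsymm.eq _ _

end Mixed

section TwoVariables

variable {P : Type*} [NormedAddCommGroup P] [NormedSpace ℝ P]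
  {A : Type*} [TopologicalSpace A] [ChartedSpace P A] [IsManifold 𝓘(ℝ, P) ∞ A]
  {E : Type*} [NormedAddCommGroup E] [NormedSpace ℝ E]
  {M : Type*} [TopologicalSpace M] [ChartedSpace E M] [IsManifold 𝓘(ℝ, E) ∞ M]
  {E' : Type*} [NormedAddCommGroup E'] [NormedSpace ℝ E']
  {M' : Type*} [TopologicalSpace M'] [ChartedSpace E' M'] [IsManifold 𝓘(ℝ, E') ∞ M']

/-- Symmetry of second derivatives for `f` read in charts. Only the target needs the moving factor
`tderiv` of its chart, since `f` leaves `q` as one variable varies; the variable being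
differentiated first stays at the base point of its chart. -/
theorem exists_mixed_tderiv {f : A × M → M'}
    (hf : ContMDiff (𝓘(ℝ, P).prod 𝓘(ℝ, E)) 𝓘(ℝ, E') ∞ f) {p : A} {m : M} {q : M'}
    (hq : f (p, m) = q) :
    ∃ L : P →L[ℝ] E →L[ℝ] E',
      HasFDerivAt (fun k => (tderiv E' E' (extChartAt 𝓘(ℝ, E') q)
          (f ((extChartAt 𝓘(ℝ, P) p).symm k, m))).comp
        (tderiv E E' (fun x => f ((extChartAt 𝓘(ℝ, P) p).symm k, x)) m)) L
          (extChartAt 𝓘(ℝ, P) p p) ∧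
      HasFDerivAt (fun y => (tderiv E' E' (extChartAt 𝓘(ℝ, E') q)
          (f (p, (extChartAt 𝓘(ℝ, E) m).symm y))).comp
        (tderiv P E' (fun g => f (g, (extChartAt 𝓘(ℝ, E) m).symm y)) p)) L.flip
          (extChartAt 𝓘(ℝ, E) m m) := by
  set c := extChartAt 𝓘(ℝ, P) p with hc
  set e := extChartAt 𝓘(ℝ, E) m with he
  set d := extChartAt 𝓘(ℝ, E') q with hd
  have hcp : c.symm (c p) = p := extChartAt_to_inv p
  have hem : e.symm (e m) = m := extChartAt_to_inv m
  have sc : ContMDiffAt 𝓘(ℝ, P) 𝓘(ℝ, P) ∞ c.symm (c p) :=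
    (contMDiffOn_extChartAt_symm p).contMDiffAt (extChartAt_target_mem_nhds p)
  have se : ContMDiffAt 𝓘(ℝ, E) 𝓘(ℝ, E) ∞ e.symm (e m) :=
    (contMDiffOn_extChartAt_symm m).contMDiffAt (extChartAt_target_mem_nhds m)
  have sF : ContDiffAt ℝ ∞ (fun z : P × E => d (f (c.symm z.1, e.symm z.2))) (c p, e m) := by
    rw [← contMDiffAt_iff_contDiffAt]
    have h1 : ContMDiffAt 𝓘(ℝ, P × E) 𝓘(ℝ, P) ∞ (fun z : P × E => c.symm z.1) (c p, e m) :=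
      ContMDiffAt.comp (c p, e m) (g := c.symm) (f := Prod.fst) sc
        (contDiff_fst.contMDiff.contMDiffAt)
    have h2 : ContMDiffAt 𝓘(ℝ, P × E) 𝓘(ℝ, E) ∞ (fun z : P × E => e.symm z.2) (c p, e m) :=
      ContMDiffAt.comp (c p, e m) (g := e.symm) (f := Prod.snd) se
        (contDiff_snd.contMDiff.contMDiffAt)
    have h3 := ContMDiffAt.comp (c p, e m) (g := f) (f := fun z : P × E => (c.symm z.1, e.symm z.2))
      hf.contMDiffAt (h1.prodMk h2)
    refine ContMDiffAt.comp (c p, e m) (g := d) ?_ h3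
    have : f (c.symm (c p), e.symm (e m)) = q := by rw [hcp, hem, hq]
    simp only [this]
    exact contMDiffAt_extChartAt
  obtain ⟨L, h1, h2⟩ := exists_mixed_deriv sF
  have hsrc : ∀ᶠ z in 𝓝 (p, m), f z ∈ d.source := by
    refine hf.continuous.continuousAt.eventually ?_
    rw [hq]
    exact extChartAt_source_mem_nhds q
  refine ⟨L, h1.congr_of_eventuallyEq ?_, h2.congr_of_eventuallyEq ?_⟩
  · have t : Tendsto (fun k => (c.symm k, m)) (𝓝 (c p)) (𝓝 (p, m)) :=
      (tendsto_chart_symm p).prodMk_nhds tendsto_const_nhds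
    filter_upwards [t.eventually hsrc] with k hk
    have hfx : MDifferentiableAt 𝓘(ℝ, E) 𝓘(ℝ, E') (fun x => f (c.symm k, x)) m :=
      (hf.comp (contMDiff_const.prodMk contMDiff_id)).contMDiffAt.mdifferentiableAt (by simp)
    rw [← tderiv_comp (E' := E') (f := fun x => f (c.symm k, x)) (mdifferentiableAt_chart hk) hfx,
      ← tderiv_eq_fderiv]
    have hfx' : MDifferentiableAt 𝓘(ℝ, E) 𝓘(ℝ, E') (fun x => d (f (c.symm k, x)))
        (e.symm (e m)) := by
      rw [hem]
      exact MDifferentiableAt.comp m (mdifferentiableAt_chart hk) hfx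
    rw [tderiv_comp (g := fun x => d (f (c.symm k, x))) hfx'
      (mdifferentiableAt_chart_symm (mem_extChartAt_target m)), tderiv_chart_symm_self, hem,
      ContinuousLinearMap.comp_id]
  · have t : Tendsto (fun y => (p, e.symm y)) (𝓝 (e m)) (𝓝 (p, m)) :=
      tendsto_const_nhds.prodMk_nhds (tendsto_chart_symm m)
    filter_upwards [t.eventually hsrc] with y hy
    have hfx : MDifferentiableAt 𝓘(ℝ, P) 𝓘(ℝ, E') (fun g => f (g, e.symm y)) p :=
      (hf.comp (contMDiff_id.prodMk contMDiff_const)).contMDiffAt.mdifferentiableAt (by simp)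
    rw [← tderiv_comp (E' := E') (f := fun g => f (g, e.symm y)) (mdifferentiableAt_chart hy) hfx,
      ← tderiv_eq_fderiv]
    have hfx' : MDifferentiableAt 𝓘(ℝ, P) 𝓘(ℝ, E') (fun g => d (f (g, e.symm y)))
        (c.symm (c p)) := by
      rw [hcp]
      exact MDifferentiableAt.comp p (mdifferentiableAt_chart hy) hfx
    rw [tderiv_comp (g := fun g => d (f (g, e.symm y))) hfx'
      (mdifferentiableAt_chart_symm (mem_extChartAt_target p)), tderiv_chart_symm_self, hcp,
      ContinuousLinearMap.comp_id]

end TwoVariables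

/-! ### Exterior derivative and Lie bracket in coordinates -/

section Coordinates

variable {E : Type*} [NormedAddCommGroup E] [NormedSpace ℝ E]
  {M : Type*} [TopologicalSpace M] [ChartedSpace E M]
  {F : Type*} [NormedAddCommGroup F] [NormedSpace ℝ F]

/-- A one-form read in the preferred chart at `m`. -/
def coordForm (θ : ∀ m : M, TangentSpace 𝓘(ℝ, E) m →L[ℝ] F) (m : M) (y : E) : E →L[ℝ] F :=
  ContinuousLinearMap.comp (θ ((extChartAt 𝓘(ℝ, E) m).symm y) : E →L[ℝ] F)
    (tderiv E E (extChartAt 𝓘(ℝ, E) m).symm y)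

/-- A vector field read in the preferred chart at `m`. -/
def coordField (X : ∀ m : M, TangentSpace 𝓘(ℝ, E) m) (m : M) (y : E) : E :=
  tderiv E E (extChartAt 𝓘(ℝ, E) m) ((extChartAt 𝓘(ℝ, E) m).symm y)
    (X ((extChartAt 𝓘(ℝ, E) m).symm y))

theorem coordForm_self [IsManifold 𝓘(ℝ, E) ∞ M] (θ : ∀ m : M, TangentSpace 𝓘(ℝ, E) m →L[ℝ] F)
    (m : M) : coordForm θ m (extChartAt 𝓘(ℝ, E) m m) = (θ m : E →L[ℝ] F) := by
  rw [coordForm, tderiv_chart_symm_self, extChartAt_to_inv]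
  rfl

theorem coordField_self [IsManifold 𝓘(ℝ, E) ∞ M] (X : ∀ m : M, TangentSpace 𝓘(ℝ, E) m) (m : M) :
    coordField X m (extChartAt 𝓘(ℝ, E) m m) = (X m : E) := by
  rw [coordField, extChartAt_to_inv, tderiv_extChartAt_self]
  rfl

theorem extDerivOneForm_eq [IsManifold 𝓘(ℝ, E) ∞ M]
    {θ : ∀ m : M, TangentSpace 𝓘(ℝ, E) m →L[ℝ] F} {m : M}
    {N : E →L[ℝ] E →L[ℝ] F}
    (h : HasFDerivAt (coordForm θ m) N (extChartAt 𝓘(ℝ, E) m m)) (u v : E) :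
    extDerivOneForm θ m u v = N u v - N v u := by
  have hs : extDerivOneForm θ m u v = extDeriv
      (fun y : E => ContinuousAlternatingMap.ofSubsingletonLIE (𝕜 := ℝ) (E := E) (F := F)
        (0 : Fin 1) (coordForm θ m y))
      (extChartAt 𝓘(ℝ, E) m m)
      ![tderiv E E (extChartAt 𝓘(ℝ, E) m) m u, tderiv E E (extChartAt 𝓘(ℝ, E) m) m v] := rfl
  have hd := (ContinuousAlternatingMap.ofSubsingletonLIE (𝕜 := ℝ) (E := E) (F := F)
    (0 : Fin 1)).toContinuousLinearEquiv.hasFDerivAt.comp _ h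
  have hd' := extDeriv_apply hd.differentiableAt ![u, v]
  rw [hs, tderiv_extChartAt_self]
  refine Eq.trans hd' ?_
  have e (w : E) : fderiv ℝ (fun y => coordForm θ m y w) (extChartAt 𝓘(ℝ, E) m m) = N.flip w :=
    (h.clm_apply (hasFDerivAt_const w _)).fderiv.trans (by ext; simp)
  have e1 : fderiv ℝ (fun y => coordForm θ m y v) (extChartAt 𝓘(ℝ, E) m m) u = N u v := by
    rw [e]; rfl
  have e2 : fderiv ℝ (fun y => coordForm θ m y u) (extChartAt 𝓘(ℝ, E) m m) v = N v u := by
    rw [e]; rfl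
  rw [← e1, ← e2]
  simp [Fin.sum_univ_two, Fin.removeNth, sub_eq_add_neg]

theorem inCoordinates_trivial {V W : Type*} [NormedAddCommGroup V] [NormedSpace ℝ V]
    [NormedAddCommGroup W] [NormedSpace ℝ W] (m x : M) (w : V →L[ℝ] W) :
    ContinuousLinearMap.inCoordinates V (Bundle.Trivial M V) W (Bundle.Trivial M W) m x m x w =
      w := by
  have h1 := Bundle.Trivial.continuousLinearMapAt_trivialization ℝ M W x
  have h2 := Bundle.Trivial.symmL_trivialization ℝ M V x
  exact ContinuousLinearMap.ext fun v => (DFunLike.congr_fun h1 _).trans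
    (congrArg w (DFunLike.congr_fun h2 v))

/-- Near `m`, the coordinate form agrees with the reading of `θ` in the trivializations of the hom
bundle, where smoothness of a section is expressed. -/
theorem differentiableAt_coordForm [IsManifold 𝓘(ℝ, E) ∞ M]
    {θ : ∀ m : M, TangentSpace 𝓘(ℝ, E) m →L[ℝ] (F →L[ℝ] ℝ)}
    (h : ContMDiff 𝓘(ℝ, E) (𝓘(ℝ, E).prod 𝓘(ℝ, E →L[ℝ] (F →L[ℝ] ℝ))) ∞
      (fun m => Bundle.TotalSpace.mk' (E →L[ℝ] (F →L[ℝ] ℝ))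
        (E := fun m : M => TangentSpace 𝓘(ℝ, E) m →L[ℝ] Bundle.Trivial M (F →L[ℝ] ℝ) m)
          m (θ m))) (m : M) :
    DifferentiableAt ℝ (coordForm θ m) (extChartAt 𝓘(ℝ, E) m m) := by
  have : IsManifold 𝓘(ℝ, E) 1 M := .of_le (n := ∞) (by simp)
  have h1 := ((contMDiffAt_hom_bundle _).1 (h.contMDiffAt (x := m))).2
  have h2 := (h1.comp_of_eq (x := extChartAt 𝓘(ℝ, E) m m)
    ((contMDiffOn_extChartAt_symm m).contMDiffAt (extChartAt_target_mem_nhds m))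
    (extChartAt_to_inv m)).contDiffAt.differentiableAt (by simp)
  refine h2.congr_of_eventuallyEq ?_
  filter_upwards [eventually_mem_chart_target m] with y hy
  have hx : (extChartAt 𝓘(ℝ, E) m).symm y ∈ (chartAt E m).source := by
    simpa using (extChartAt 𝓘(ℝ, E) m).map_target hy
  have h3 := TangentBundle.symmL_trivializationAt (I := 𝓘(ℝ, E)) hx
  rw [(extChartAt 𝓘(ℝ, E) m).right_inv hy] at h3
  have h4 (w : F →L[ℝ] ℝ) :
      (trivializationAt (F →L[ℝ] ℝ) (Bundle.Trivial M (F →L[ℝ] ℝ)) m).continuousLinearMapAt ℝ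
        ((extChartAt 𝓘(ℝ, E) m).symm y) w = w := by
    simp
    exact inCoordinates_trivial m _ w
  rw [modelWithCornersSelf_coe, Set.range_id, mfderivWithin_univ] at h3
  refine ContinuousLinearMap.ext fun v => ?_
  refine Eq.trans ?_ (h4 _).symm
  exact congrArg (θ ((extChartAt 𝓘(ℝ, E) m).symm y)) (DFunLike.congr_fun h3 v).symm

/-- The pullback of a vector field by the inverse chart is its coordinate expression. -/
theorem mpullbackWithin_symm_eventuallyEq [IsManifold 𝓘(ℝ, E) ∞ M]
    (X : ∀ m : M, TangentSpace 𝓘(ℝ, E) m) (m : M) :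
    (VectorField.mpullbackWithin 𝓘(ℝ, E) 𝓘(ℝ, E) (extChartAt 𝓘(ℝ, E) m).symm X
      (Set.range 𝓘(ℝ, E)) : E → E) =ᶠ[𝓝 (extChartAt 𝓘(ℝ, E) m m)] coordField X m := by
  have : IsManifold 𝓘(ℝ, E) 1 M := .of_le (n := ∞) (by simp)
  filter_upwards [eventually_mem_chart_target m] with y hy
  have h1 := mfderivWithin_extChartAt_symm_comp_mfderiv_extChartAt (I := 𝓘(ℝ, E)) hy
  have h2 := mfderiv_extChartAt_comp_mfderivWithin_extChartAt_symm (I := 𝓘(ℝ, E)) hy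
  have h3 := ContinuousLinearMap.inverse_eq h1 h2
  rw [VectorField.mpullbackWithin_apply, h3]
  rfl

theorem differentiableAt_coordField [CompleteSpace E] [IsManifold 𝓘(ℝ, E) ∞ M]
    {X : ∀ m : M, TangentSpace 𝓘(ℝ, E) m} {m : M}
    (h : MDifferentiableAt 𝓘(ℝ, E) 𝓘(ℝ, E).tangent
      (fun m => (⟨m, X m⟩ : TangentBundle 𝓘(ℝ, E) M)) m) :
    DifferentiableAt ℝ (coordField X m) (extChartAt 𝓘(ℝ, E) m m) := by
  have : IsManifold 𝓘(ℝ, E) 2 M := .of_le (n := ∞) (by norm_cast)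
  have := MDifferentiableWithinAt.differentiableWithinAt_mpullbackWithin_vectorField
    (mdifferentiableWithinAt_univ.2 h)
  have hset : (extChartAt 𝓘(ℝ, E) m).symm ⁻¹' Set.univ ∩ Set.range 𝓘(ℝ, E) = Set.univ := by simp
  rw [hset] at this
  exact (DifferentiableWithinAt.differentiableAt (F := E) this
    Filter.univ_mem).congr_of_eventuallyEq
    (mpullbackWithin_symm_eventuallyEq X m).symm

/-- The bracket is computed in the chart at `m` and pulled back by the derivative of that chart,
which is the identity at `m`. -/
theorem mlieBracket_eq [IsManifold 𝓘(ℝ, E) ∞ M]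
    (X Y : ∀ m : M, TangentSpace 𝓘(ℝ, E) m) (m : M) :
    VectorField.mlieBracket 𝓘(ℝ, E) X Y m =
      (fderiv ℝ (coordField Y m) (extChartAt 𝓘(ℝ, E) m m) (X m : E)
        - fderiv ℝ (coordField X m) (extChartAt 𝓘(ℝ, E) m m) (Y m : E) : E) := by
  have : IsManifold 𝓘(ℝ, E) 1 M := .of_le (n := ∞) (by simp)
  have hset : (extChartAt 𝓘(ℝ, E) m).symm ⁻¹' Set.univ ∩ Set.range 𝓘(ℝ, E) = Set.univ := by simp
  have h3 := (mpullbackWithin_symm_eventuallyEq X m).lieBracket_vectorField_eq (𝕜 := ℝ)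
    (mpullbackWithin_symm_eventuallyEq Y m)
  have h4 (w : E) : (mfderiv 𝓘(ℝ, E) 𝓘(ℝ, E) (extChartAt 𝓘(ℝ, E) m) m).inverse w = w := by
    have h5 : ContinuousLinearMap.inverse (tderiv E E (extChartAt 𝓘(ℝ, E) m) m) w = w := by
      rw [tderiv_extChartAt_self, ContinuousLinearMap.inverse_id]
      rfl
    exact h5
  refine (h4 _).trans (Eq.trans ?_ (h3.trans ?_))
  · rw [hset]
    exact congrFun (VectorField.lieBracketWithin_univ (𝕜 := ℝ) (E := E)) _
  · rw [VectorField.lieBracket, coordField_self, coordField_self]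

end Coordinates

theorem hasFDerivAt_comp_of_eq {E F H : Type*} [NormedAddCommGroup E] [NormedSpace ℝ E]
    [NormedAddCommGroup F] [NormedSpace ℝ F] [NormedAddCommGroup H] [NormedSpace ℝ H]
    {g : F → H} {f : E → F} {g' : F →L[ℝ] H} {f' : E →L[ℝ] F} {x : E} {y : F}
    (hg : HasFDerivAt g g' y) (hf : HasFDerivAt f f' x) (h : f x = y) :
    HasFDerivAt (fun z => g (f z)) (g'.comp f') x := by
  subst h
  exact hg.comp x hf

/-! ### Infinitesimal generators and the adjoint representation -/

section Actions

variable {E : Type*} [NormedAddCommGroup E] [NormedSpace ℝ E]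
  {EG : Type*} [NormedAddCommGroup EG] [NormedSpace ℝ EG]
  {G : Type*} [TopologicalSpace G] [ChartedSpace EG G] [Group G] [LieGroup 𝓘(ℝ, EG) ∞ G]
  {M : Type*} [TopologicalSpace M] [ChartedSpace E M] [IsManifold 𝓘(ℝ, E) ∞ M]
  [MulAction G M] [ContMDiffSMul 𝓘(ℝ, EG) 𝓘(ℝ, E) ∞ G M]

theorem isManifold_of_lieGroup : IsManifold 𝓘(ℝ, EG) ∞ G :=
  ContMDiffMul.toIsManifold

variable (E EG) in
/-- The infinitesimal generator map at `m`, as a map between the model spaces. -/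
def gen (G : Type*) [TopologicalSpace G] [ChartedSpace EG G] [Group G] [MulAction G M] (m : M) :
    EG →L[ℝ] E :=
  tderiv EG E (fun g : G => g • m) 1

/-- The infinitesimal generator map read in the preferred chart at `m`. -/
def coordGen (G : Type*) [TopologicalSpace G] [ChartedSpace EG G] [Group G] [MulAction G M]
    (m : M) (y : E) : EG →L[ℝ] E :=
  (tderiv E E (extChartAt 𝓘(ℝ, E) m) ((extChartAt 𝓘(ℝ, E) m).symm y)).comp
    (gen E EG G ((extChartAt 𝓘(ℝ, E) m).symm y))

variable (G) in
-- One bilinear map serves two purposes: `L ζ` is the derivative at `1`, in the direction `ζ`, of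
-- the tangent maps of the action, and also the derivative at `m` of the vector field `ζ_M`.
theorem exists_mixed_smul (m : M) :
    ∃ L : EG →L[ℝ] E →L[ℝ] E,
      HasFDerivAt (fun k => (tderiv E E (extChartAt 𝓘(ℝ, E) m)
          ((extChartAt 𝓘(ℝ, EG) (1 : G)).symm k • m)).comp
        (tderiv E E (fun x : M => (extChartAt 𝓘(ℝ, EG) (1 : G)).symm k • x) m)) L
          (extChartAt 𝓘(ℝ, EG) (1 : G) 1) ∧
      HasFDerivAt (coordGen (EG := EG) G m) L.flip (extChartAt 𝓘(ℝ, E) m m) := by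
  have : IsManifold 𝓘(ℝ, EG) ∞ G := isManifold_of_lieGroup
  obtain ⟨L, h1, h2⟩ := exists_mixed_tderiv (P := EG) (E := E) (E' := E)
    (f := fun z : G × M => z.1 • z.2) contMDiff_smul (one_smul G m)
  refine ⟨L, h1, ?_⟩
  simp only [one_smul] at h2
  exact h2

theorem Ad_eq (g : G) : Ad (EG := EG) g = tderiv EG EG (fun h : G => g * h * g⁻¹) 1 := rfl

theorem contMDiff_conj :
    ContMDiff (𝓘(ℝ, EG).prod 𝓘(ℝ, EG)) 𝓘(ℝ, EG) ∞ (fun z : G × G => z.1 * z.2 * z.1⁻¹) :=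
  have := topologicalGroup_of_lieGroup 𝓘(ℝ, EG) ∞ (G := G)
  (contMDiff_fst.mul contMDiff_snd).mul contMDiff_fst.inv

theorem mdifferentiableAt_conj (g h : G) :
    MDifferentiableAt 𝓘(ℝ, EG) 𝓘(ℝ, EG) (fun h : G => g * h * g⁻¹) h :=
  (contMDiff_conj.comp (contMDiff_const.prodMk contMDiff_id)).contMDiffAt.mdifferentiableAt
    (by simp)

variable (EG) in
theorem Ad_one : Ad (EG := EG) (1 : G) = ContinuousLinearMap.id ℝ EG := by
  rw [Ad_eq, ← tderiv_id (1 : G)]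
  simp

variable (EG) in
theorem Ad_mul (g h : G) : Ad (EG := EG) (g * h) = (Ad g).comp (Ad h) := by
  have h1 : h * 1 * h⁻¹ = 1 := by simp
  have := tderiv_comp (g := fun x : G => g * x * g⁻¹) (f := fun x : G => h * x * h⁻¹) (x := 1)
    (mdifferentiableAt_conj (EG := EG) g _) (mdifferentiableAt_conj (EG := EG) h 1)
  rw [h1] at this
  rw [Ad_eq, Ad_eq, Ad_eq, ← this]
  congr 1
  ext x
  group

variable (EG) in
-- Conjugation fixes `1`, so the chart factor in the mixed derivative is constantly the identity.
theorem exists_hasFDerivAt_Ad (G : Type*) [TopologicalSpace G] [ChartedSpace EG G] [Group G]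
    [LieGroup 𝓘(ℝ, EG) ∞ G] :
    ∃ B : EG →L[ℝ] EG →L[ℝ] EG,
      HasFDerivAt (fun k => Ad (EG := EG) ((extChartAt 𝓘(ℝ, EG) (1 : G)).symm k)) B
        (extChartAt 𝓘(ℝ, EG) (1 : G) 1) := by
  have : IsManifold 𝓘(ℝ, EG) ∞ G := isManifold_of_lieGroup
  obtain ⟨B, h, -⟩ := exists_mixed_tderiv (f := fun z : G × G => z.1 * z.2 * z.1⁻¹) (p := 1)
    (m := 1) (q := 1) (contMDiff_conj (EG := EG)) (by simp)
  refine ⟨B, h.congr_of_eventuallyEq (.of_forall fun k => ?_)⟩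
  have h1 : (extChartAt 𝓘(ℝ, EG) (1 : G)).symm k * 1 *
      ((extChartAt 𝓘(ℝ, EG) (1 : G)).symm k)⁻¹ = 1 := by
    simp
  simp only [h1, tderiv_extChartAt_self, Ad_eq, ContinuousLinearMap.id_comp]

variable (EG) in
/-- The derivative of the adjoint representation at the unit. -/
def ad (G : Type*) [TopologicalSpace G] [ChartedSpace EG G] [Group G]
    [LieGroup 𝓘(ℝ, EG) ∞ G] : EG →L[ℝ] EG →L[ℝ] EG :=
  fderiv ℝ (fun k => Ad (EG := EG) ((extChartAt 𝓘(ℝ, EG) (1 : G)).symm k))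
    (extChartAt 𝓘(ℝ, EG) (1 : G) 1)

variable (G) in
theorem hasFDerivAt_Ad :
    HasFDerivAt (fun k => Ad (EG := EG) ((extChartAt 𝓘(ℝ, EG) (1 : G)).symm k)) (ad EG G)
      (extChartAt 𝓘(ℝ, EG) (1 : G) 1) :=
  (exists_hasFDerivAt_Ad EG G).choose_spec.differentiableAt.hasFDerivAt

/-- The derivative of a map between manifolds, computed in the preferred charts. -/
theorem hasFDerivAt_writtenInCharts {N : Type*} [NormedAddCommGroup N] [NormedSpace ℝ N]
    {A : Type*} [TopologicalSpace A] [ChartedSpace N A] [IsManifold 𝓘(ℝ, N) ∞ A]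
    {f : A → M} {x : A} {q : M} (hf : MDifferentiableAt 𝓘(ℝ, N) 𝓘(ℝ, E) f x) (hq : f x = q) :
    HasFDerivAt (fun y => extChartAt 𝓘(ℝ, E) q (f ((extChartAt 𝓘(ℝ, N) x).symm y)))
      (tderiv N E f x) (extChartAt 𝓘(ℝ, N) x x) := by
  subst hq
  have hx := extChartAt_to_inv (I := 𝓘(ℝ, N)) x
  have h1 := mdifferentiableAt_chart_symm (mem_extChartAt_target (I := 𝓘(ℝ, N)) x)
  have h2 : MDifferentiableAt 𝓘(ℝ, N) 𝓘(ℝ, E) (fun z => extChartAt 𝓘(ℝ, E) (f x) (f z))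
      ((extChartAt 𝓘(ℝ, N) x).symm (extChartAt 𝓘(ℝ, N) x x)) := by
    rw [hx]
    exact MDifferentiableAt.comp x (mdifferentiableAt_chart (mem_extChartAt_source _)) hf
  have h3 := (MDifferentiableAt.comp _ h2 h1).differentiableAt.hasFDerivAt
  rw [← tderiv_eq_fderiv] at h3
  have h4 := tderiv_comp h2 h1
  rw [hx, tderiv_chart_symm_self, ContinuousLinearMap.comp_id,
    tderiv_comp (mdifferentiableAt_chart (mem_extChartAt_source _)) hf, tderiv_extChartAt_self,
    ContinuousLinearMap.id_comp] at h4
  rw [← h4]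
  exact h3

/-- The chain rule for a map into the group that takes the value `1` at the base point. -/
theorem hasFDerivAt_comp_of_eq_one {N F : Type*} [NormedAddCommGroup N] [NormedSpace ℝ N]
    [NormedAddCommGroup F] [NormedSpace ℝ F] {f : G → F} {f' : EG →L[ℝ] F}
    (hf : HasFDerivAt (fun k => f ((extChartAt 𝓘(ℝ, EG) (1 : G)).symm k)) f'
      (extChartAt 𝓘(ℝ, EG) (1 : G) 1)) {A : Type*} [TopologicalSpace A] [ChartedSpace N A]
    [IsManifold 𝓘(ℝ, N) ∞ A] {ψ : A → G} {x : A}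
    (hψ : MDifferentiableAt 𝓘(ℝ, N) 𝓘(ℝ, EG) ψ x) (h1 : ψ x = 1) :
    HasFDerivAt (fun y => f (ψ ((extChartAt 𝓘(ℝ, N) x).symm y))) (f'.comp (tderiv N EG ψ x))
      (extChartAt 𝓘(ℝ, N) x x) := by
  have : IsManifold 𝓘(ℝ, EG) ∞ G := isManifold_of_lieGroup
  have h2 := hasFDerivAt_writtenInCharts hψ h1
  refine (hasFDerivAt_comp_of_eq hf h2 (by rw [extChartAt_to_inv, h1])).congr_of_eventuallyEq ?_
  have h3 : ∀ᶠ z in 𝓝 x, ψ z ∈ (extChartAt 𝓘(ℝ, EG) (1 : G)).source :=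
    hψ.continuousAt.eventually (by rw [h1]; exact extChartAt_source_mem_nhds 1)
  filter_upwards [(tendsto_chart_symm x).eventually h3] with y hy
  simp only [(extChartAt 𝓘(ℝ, EG) (1 : G)).left_inv hy]

theorem mdifferentiableAt_smul_const (g : G) (m : M) :
    MDifferentiableAt 𝓘(ℝ, EG) 𝓘(ℝ, E) (fun g : G => g • m) g :=
  ((contMDiff_smul (I := 𝓘(ℝ, EG)) (I' := 𝓘(ℝ, E)) (n := ∞)).comp
    (contMDiff_id.prodMk contMDiff_const)).contMDiffAt.mdifferentiableAt (by simp)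

variable (EG) in
theorem mdifferentiableAt_const_smul {G : Type*} [TopologicalSpace G] [ChartedSpace EG G] [Group G]
    [MulAction G M] [ContMDiffSMul 𝓘(ℝ, EG) 𝓘(ℝ, E) ∞ G M] (g : G) (m : M) :
    MDifferentiableAt 𝓘(ℝ, E) 𝓘(ℝ, E) (fun m : M => g • m) m :=
  ((contMDiff_smul (I := 𝓘(ℝ, EG)) (I' := 𝓘(ℝ, E)) (n := ∞)).comp
    (contMDiff_const.prodMk contMDiff_id)).contMDiffAt.mdifferentiableAt (by simp)

/-- Differentiate `(g h g⁻¹) • (g • m) = g • (h • m)` in `h` at `1`. -/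
theorem gen_smul_Ad (g : G) (m : M) (η : EG) :
    gen E EG G (g • m) (Ad g η) =
      tderiv E E (fun x : M => g • x) m (gen E EG G m η) := by
  have h1 : g * 1 * g⁻¹ = 1 := by simp
  have ha := tderiv_comp (x := (1 : G))
    (mdifferentiableAt_smul_const (E := E) (g * 1 * g⁻¹) (g • m))
    (mdifferentiableAt_conj (EG := EG) g 1)
  have hb := tderiv_comp (x := (1 : G)) (f := fun h : G => h • m)
    (mdifferentiableAt_const_smul (E := E) EG g ((1 : G) • m))
    (mdifferentiableAt_smul_const (EG := EG) (E := E) 1 m)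
  rw [h1] at ha
  rw [one_smul] at hb
  have hc : (fun h : G => (g * h * g⁻¹) • g • m) = fun h => g • h • m := by
    ext h
    simp [mul_smul]
  rw [hc, hb] at ha
  exact DFunLike.congr_fun ha.symm η

variable (E EG G) in
theorem eventually_smul_mem_source (m : M) :
    ∀ᶠ k in 𝓝 (extChartAt 𝓘(ℝ, EG) (1 : G) 1),
      (extChartAt 𝓘(ℝ, EG) (1 : G)).symm k • m ∈ (extChartAt 𝓘(ℝ, E) m).source := by
  have hc := (mdifferentiableAt_smul_const (EG := EG) (E := E) (1 : G) m).continuousAt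
  have h1 : (extChartAt 𝓘(ℝ, E) m).source ∈ 𝓝 ((1 : G) • m) := by
    rw [one_smul]
    exact extChartAt_source_mem_nhds m
  exact (tendsto_chart_symm (1 : G)).eventually (hc.eventually h1)

theorem coordGen_self (G : Type*) [TopologicalSpace G] [ChartedSpace EG G] [Group G]
    [MulAction G M] (m : M) :
    coordGen (EG := EG) G m (extChartAt 𝓘(ℝ, E) m m) = gen E EG G m := by
  rw [coordGen, extChartAt_to_inv, tderiv_extChartAt_self, ContinuousLinearMap.id_comp]

variable (G) in
-- Differentiate `gen_smul_Ad` in the group element at `1`, in the direction `ζ`. For a left action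
-- the right-hand side is `-[ζ_M, η_M]`.
theorem gen_ad {m : M} {L : EG →L[ℝ] E →L[ℝ] E}
    (h1 : HasFDerivAt (fun k => (tderiv E E (extChartAt 𝓘(ℝ, E) m)
          ((extChartAt 𝓘(ℝ, EG) (1 : G)).symm k • m)).comp
        (tderiv E E (fun x : M => (extChartAt 𝓘(ℝ, EG) (1 : G)).symm k • x) m)) L
          (extChartAt 𝓘(ℝ, EG) (1 : G) 1))
    (h2 : HasFDerivAt (coordGen (EG := EG) G m) L.flip (extChartAt 𝓘(ℝ, E) m m)) (ζ η : EG) :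
    gen E EG G m (ad EG G ζ η) =
      L ζ (gen E EG G m η) - L η (gen E EG G m ζ) := by
  have : IsManifold 𝓘(ℝ, EG) ∞ G := isManifold_of_lieGroup
  have hs := hasFDerivAt_writtenInCharts
    (mdifferentiableAt_smul_const (EG := EG) (E := E) (1 : G) m) (one_smul G m)
  have hl := (hasFDerivAt_comp_of_eq h2 hs (by rw [extChartAt_to_inv, one_smul])).clm_apply
    ((hasFDerivAt_Ad (EG := EG) G).clm_apply (hasFDerivAt_const η _))
  have hr := h1.clm_apply (hasFDerivAt_const (gen E EG G m η) _)
  have he := hl.unique (hr.congr_of_eventuallyEq ?_)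
  · have := DFunLike.congr_fun he ζ
    simp only [extChartAt_to_inv, one_smul, coordGen_self, Ad_one, ContinuousLinearMap.comp_zero,
      zero_add, add_apply, ContinuousLinearMap.comp_apply,
      ContinuousLinearMap.flip_apply, ContinuousLinearMap.id_apply] at this
    exact eq_sub_of_add_eq this
  · filter_upwards [eventually_smul_mem_source E EG G m] with k hk
    simp only [coordGen, (extChartAt 𝓘(ℝ, E) m).left_inv hk,
      ContinuousLinearMap.comp_apply]
    exact congrArg _ (gen_smul_Ad _ m η)

/-- Differentiate `Ad_{g k g⁻¹} Ad_g η = Ad_g Ad_k η` in `k` at `1`. -/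
theorem ad_Ad (g : G) (ζ η : EG) : ad EG G (Ad g ζ) (Ad g η) = Ad g (ad EG G ζ η) := by
  have : IsManifold 𝓘(ℝ, EG) ∞ G := isManifold_of_lieGroup
  have hl := (hasFDerivAt_comp_of_eq_one (hasFDerivAt_Ad (EG := EG) G)
    (mdifferentiableAt_conj g 1) (by simp)).clm_apply (hasFDerivAt_const (Ad g η) _)
  have hr := (Ad (EG := EG) g).hasFDerivAt.comp _
    ((hasFDerivAt_Ad (EG := EG) G).clm_apply (hasFDerivAt_const η _))
  have he := hl.unique (hr.congr_of_eventuallyEq (.of_forall fun k => ?_))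
  · have := DFunLike.congr_fun he ζ
    simpa [← Ad_eq] using this
  · simp only [Function.comp_apply, ← ContinuousLinearMap.comp_apply, ← Ad_mul]
    simp

/-- Apply `gen_ad` to left multiplication of `G` on itself, where the generator map at `1` is the
identity. The tangent maps of left translations applied to `ξ` form the left-invariant field of `ξ`,
so its derivative at `1` is `L.flip ξ`, and the bracket becomes `L ζ η - L η ζ`. -/
theorem lieBracket_eq_ad (ζ η : EG) : (lieBracket G ζ η : EG) = ad EG G ζ η := by
  have : IsManifold 𝓘(ℝ, EG) ∞ G := isManifold_of_lieGroup
  obtain ⟨L, h1, h2⟩ := exists_mixed_smul (EG := EG) (E := EG) G (1 : G)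
  have h3 : gen EG EG G (1 : G) = ContinuousLinearMap.id ℝ EG := by
    rw [gen, ← tderiv_id (1 : G)]
    simp only [smul_eq_mul, mul_one]
  have h4 := gen_ad G h1 h2 ζ η
  have h5 (ξ : EG) : HasFDerivAt (coordField (mulInvariantVectorField (I := 𝓘(ℝ, EG)) (G := G) ξ) 1)
      (L.flip ξ) (extChartAt 𝓘(ℝ, EG) (1 : G) 1) := by
    have h6 := h1.clm_apply (hasFDerivAt_const ξ _)
    simp only [smul_eq_mul, mul_one] at h6
    convert! h6 using 1
    ext v
    simp
  have h6 (ξ : EG) : (mulInvariantVectorField (I := 𝓘(ℝ, EG)) (G := G) ξ 1 : EG) = ξ := by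
    have : tderiv EG EG (fun x : G => 1 * x) 1 ξ = ξ := by
      simp only [one_mul, tderiv_id]
      rfl
    exact this
  have h7 := mlieBracket_eq (mulInvariantVectorField (I := 𝓘(ℝ, EG)) (G := G) ζ)
    (mulInvariantVectorField (I := 𝓘(ℝ, EG)) (G := G) η) 1
  rw [(h5 ζ).fderiv, (h5 η).fderiv, h6, h6] at h7
  rw [h3] at h4
  exact h7.trans h4.symm

theorem ad_mem_isotropyAlg {m : M} {ζ η : EG} (hζ : ζ ∈ isotropyAlg (EG := EG) E G m)
    (hη : η ∈ isotropyAlg (EG := EG) E G m) : ad EG G ζ η ∈ isotropyAlg (EG := EG) E G m := by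
  obtain ⟨L, h1, h2⟩ := exists_mixed_smul (EG := EG) (E := E) G m
  have h3 := gen_ad G h1 h2 ζ η
  have hζ' : gen E EG G m ζ = 0 := hζ
  have hη' : gen E EG G m η = 0 := hη
  rw [hζ', hη', map_zero, map_zero, sub_zero] at h3
  exact h3

end Actions

/-! ### The dual connection form and its curvature -/

section Main

variable {E : Type*} [NormedAddCommGroup E] [NormedSpace ℝ E]
  {EG : Type*} [NormedAddCommGroup EG] [NormedSpace ℝ EG]
  {G : Type*} [TopologicalSpace G] [ChartedSpace EG G] [Group G] [LieGroup 𝓘(ℝ, EG) ∞ G]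
  {M : Type*} [TopologicalSpace M] [ChartedSpace E M] [IsManifold 𝓘(ℝ, E) ∞ M]
  [MulAction G M] [ContMDiffSMul 𝓘(ℝ, EG) 𝓘(ℝ, E) ∞ G M]

theorem Ad_comp_Ad_inv (g : G) (ξ : EG) : Ad g (Ad g⁻¹ ξ) = ξ := by
  rw [← ContinuousLinearMap.comp_apply, ← Ad_mul, mul_inv_cancel, Ad_one]
  rfl

namespace DualConnectionForm

variable (μ : DualConnectionForm E EG G M)

/-- The value of the form at a point, as a map between the model spaces. -/
def form (m : M) : E →L[ℝ] EG →L[ℝ] ℝ := μ.toForm m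

theorem differentiableAt_coordForm (m : M) :
    DifferentiableAt ℝ (coordForm μ.toForm m) (extChartAt 𝓘(ℝ, E) m m) :=
  PartialConn.differentiableAt_coordForm μ.smooth m

theorem exists_hasFDerivAt_coordForm (m : M) : ∃ N : E →L[ℝ] E →L[ℝ] EG →L[ℝ] ℝ,
    HasFDerivAt (coordForm μ.toForm m) N (extChartAt 𝓘(ℝ, E) m m) :=
  ⟨_, (μ.differentiableAt_coordForm m).hasFDerivAt⟩

theorem coordForm_apply (m : M) (y v : E) : coordForm μ.toForm m y v =
    μ.form ((extChartAt 𝓘(ℝ, E) m).symm y) (tderiv E E (extChartAt 𝓘(ℝ, E) m).symm y v) := rfl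

theorem coordForm_eq_form (m : M) : coordForm μ.toForm m (extChartAt 𝓘(ℝ, E) m m) = μ.form m :=
  coordForm_self _ _

theorem coordForm_chart {m : M} {y : E} (hy : y ∈ (extChartAt 𝓘(ℝ, E) m).target) (w : E) :
    coordForm μ.toForm m y
      (tderiv E E (extChartAt 𝓘(ℝ, E) m) ((extChartAt 𝓘(ℝ, E) m).symm y) w) =
    μ.form ((extChartAt 𝓘(ℝ, E) m).symm y) w := by
  have h := DFunLike.congr_fun (tderiv_symm_comp_chart ((extChartAt 𝓘(ℝ, E) m).map_target hy)) w
  rw [(extChartAt 𝓘(ℝ, E) m).right_inv hy, ContinuousLinearMap.comp_apply,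
    ContinuousLinearMap.id_apply] at h
  rw [coordForm_apply, h]

theorem form_equivariant (g : G) (m : M) (v : E) :
    μ.form (g • m) (tderiv E E (fun x : M => g • x) m v) = (μ.form m v).comp (Ad g⁻¹) :=
  μ.equivariant g m v

theorem exists_eq_add (m : M) (v : E) :
    ∃ (ξ : EG) (h : E), μ.form m h = 0 ∧ v = h + gen E EG G m ξ := by
  obtain ⟨a, ⟨ξ, rfl⟩, h, hh, rfl⟩ := Submodule.mem_sup.1
    ((μ.isCompl m).sup_eq_top ▸ Submodule.mem_top : (v : TangentSpace 𝓘(ℝ, E) m) ∈ _)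
  exact ⟨ξ, h, hh, add_comm _ _⟩

theorem horProj_add_gen (m : M) {h : E} (hh : μ.form m h = 0) (ξ : EG) :
    μ.horProj m (h + gen E EG G m ξ : E) = h := by
  have h1 : μ.horProj m h = h := Submodule.projection_apply_left _ ⟨h, hh⟩
  have h2 : μ.horProj m (gen E EG G m ξ) = 0 :=
    (Submodule.projection_apply_eq_zero_iff _).2 ⟨ξ, rfl⟩
  have h3 := (μ.horProj m).map_add h (gen E EG G m ξ)
  rw [h1, h2] at h3
  exact h3.trans (add_zero _)

/-- The coordinate form of the infinitesimal equivariance of `μ`, on horizontal vectors. -/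
theorem fderiv_coordForm_gen {m : M} {L : EG →L[ℝ] E →L[ℝ] E}
    (h1 : HasFDerivAt (fun k => (tderiv E E (extChartAt 𝓘(ℝ, E) m)
          ((extChartAt 𝓘(ℝ, EG) (1 : G)).symm k • m)).comp
        (tderiv E E (fun x : M => (extChartAt 𝓘(ℝ, EG) (1 : G)).symm k • x) m)) L
          (extChartAt 𝓘(ℝ, EG) (1 : G) 1))
    {N : E →L[ℝ] E →L[ℝ] EG →L[ℝ] ℝ}
    (h2 : HasFDerivAt (coordForm μ.toForm m) N (extChartAt 𝓘(ℝ, E) m m)) {v : E}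
    (hv : μ.form m v = 0) (ζ : EG) :
    N (gen E EG G m ζ) v + μ.form m (L ζ v) = 0 := by
  have : IsManifold 𝓘(ℝ, EG) ∞ G := isManifold_of_lieGroup
  have hs := hasFDerivAt_writtenInCharts
    (mdifferentiableAt_smul_const (EG := EG) (E := E) (1 : G) m) (one_smul G m)
  have hl := (hasFDerivAt_comp_of_eq h2 hs (by rw [extChartAt_to_inv, one_smul])).clm_apply
    (h1.clm_apply (hasFDerivAt_const v _))
  -- For horizontal `v` the equivariance identity has right-hand side zero for every group element,
  -- so no derivative of `Ad` appears.
  have he := hl.unique ((hasFDerivAt_const (0 : EG →L[ℝ] ℝ) _).congr_of_eventuallyEq ?_)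
  · have h3 := DFunLike.congr_fun he ζ
    simp only [extChartAt_to_inv, one_smul, coordForm_self, tderiv_extChartAt_self,
      ContinuousLinearMap.comp_zero, zero_add, add_apply, ContinuousLinearMap.comp_apply,
      ContinuousLinearMap.flip_apply, ContinuousLinearMap.id_apply, tderiv_id, zero_apply] at h3
    rw [add_comm]
    exact h3
  · filter_upwards [eventually_smul_mem_source E EG G m] with k hk
    have h4 := DFunLike.congr_fun (tderiv_symm_comp_chart hk)
      (tderiv E E (fun x : M => (extChartAt 𝓘(ℝ, EG) (1 : G)).symm k • x) m v)
    simp only [ContinuousLinearMap.comp_apply, ContinuousLinearMap.id_apply] at h4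
    have h5 := μ.form_equivariant ((extChartAt 𝓘(ℝ, EG) (1 : G)).symm k) m v
    rw [hv, ContinuousLinearMap.zero_comp, ← h4] at h5
    rw [μ.coordForm_apply, (extChartAt 𝓘(ℝ, E) m).left_inv hk]
    exact h5

/-- Docility gives `∇μ = μ(w)`; dropping the horizontal part of `w` leaves `∇μ = χ(ξ)`. So `gamma`
is evaluated on the range of `χ`, off its default value, and `μ(ξ_M)` returns `∇μ`, which is `dμ` on
the horizontal parts `h`, `k`. -/
theorem form_curvature {m : M} (hd : μ.DocileAt m) {N : E →L[ℝ] E →L[ℝ] EG →L[ℝ] ℝ}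
    (hN : HasFDerivAt (coordForm μ.toForm m) N (extChartAt 𝓘(ℝ, E) m m)) {h k : E}
    (hh : μ.form m h = 0) (hk : μ.form m k = 0) (ζ η : EG) :
    μ.form m (μ.curvature m (h + gen E EG G m ζ : E) (k + gen E EG G m η : E)) = N h k - N k h := by
  have h1 : μ.covDeriv m (h + gen E EG G m ζ : E) (k + gen E EG G m η : E) = N h k - N k h := by
    exact (congrArg₂ (extDerivOneForm μ.toForm m) (μ.horProj_add_gen m hh ζ)
      (μ.horProj_add_gen m hk η)).trans (extDerivOneForm_eq hN h k)
  obtain ⟨w, hw⟩ := hd (h + gen E EG G m ζ : E) (k + gen E EG G m η : E)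
  obtain ⟨ξ, l, hl, rfl⟩ := μ.exists_eq_add m w
  have h2 : μ.inertia m ξ = N h k - N k h := by
    rw [← h1, ← hw]
    refine Eq.symm ((map_add (μ.form m) _ _).trans ?_)
    rw [hl, zero_add]
    rfl
  refine (congrArg (fun ν => μ.form m (μ.gamma m ν)) (h1.trans h2.symm)).trans ?_
  exact (congrArg (μ.form m) (μ.gamma_inertia m ξ)).trans h2

end DualConnectionForm

/-! ### The almost horizontal system as a kernel, and its brackets -/

namespace Adaptor

variable {m₀ : M} (φ : Adaptor E EG G m₀) (μ : DualConnectionForm E EG G M)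
  {π : EG →L[ℝ] EG} {ι : M → (EG →L[ℝ] ℝ) →L[ℝ] EG}

theorem mem_almostHorizontal_iff_exists (m : M) (v : TangentSpace 𝓘(ℝ, E) m) :
    v ∈ φ.almostHorizontal μ m ↔
      ∃ (h : E) (ζ : EG), μ.form m h = 0 ∧ ζ ∈ isotropyAlg (EG := EG) E G m₀ ∧
        v = (h + gen E EG G m (Ad (φ.toFun m) ζ) : E) := by
  constructor
  · intro hv
    obtain ⟨h, hh, w, hw, hsum⟩ := Submodule.mem_sup.1 hv
    obtain ⟨_, ⟨ζ, hζ, rfl⟩, rfl⟩ := hw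
    exact ⟨h, ζ, hh, hζ, hsum.symm⟩
  · rintro ⟨h, ζ, hh, hζ, hsum⟩
    exact Submodule.mem_sup.2 ⟨h, hh, _, ⟨_, ⟨ζ, hζ, rfl⟩, rfl⟩, hsum.symm⟩

theorem comp_form_gen (hι : φ.IsRestrictedPseudoInverse μ π ι) {m : M} (hm : m ∈ φ.domain)
    (ζ : EG) : π (ι m (μ.form m (gen E EG G m (Ad (φ.toFun m) ζ)))) = π ζ :=
  (DFunLike.congr_fun (hι.comp_eq m hm) ζ).symm

theorem mem_isotropyAlg_iff (hπ : IsIsotropyProjection E G m₀ π) (ζ : EG) :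
    ζ ∈ isotropyAlg (EG := EG) E G m₀ ↔ π ζ = 0 := by
  rw [← hπ.ker_eq]
  rfl

/-- The almost horizontal system is the kernel of the one-form `π ∘ ι ∘ μ`. -/
theorem mem_almostHorizontal_iff (hπ : IsIsotropyProjection E G m₀ π)
    (hι : φ.IsRestrictedPseudoInverse μ π ι) {m : M} (hm : m ∈ φ.domain)
    (v : TangentSpace 𝓘(ℝ, E) m) :
    v ∈ φ.almostHorizontal μ m ↔ π (ι m (μ.form m v)) = 0 := by
  rw [mem_almostHorizontal_iff_exists]
  constructor
  · rintro ⟨h, ζ, hh, hζ, rfl⟩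
    rw [map_add, map_add, map_add, hh, map_zero, map_zero, zero_add, φ.comp_form_gen μ hι hm]
    exact (mem_isotropyAlg_iff hπ ζ).1 hζ
  · intro h0
    obtain ⟨ξ, h, hh, rfl⟩ := μ.exists_eq_add m v
    -- Since `ξ = Ad_φ (Ad_φ⁻¹ ξ)`, the form takes the value `π (Ad_φ⁻¹ ξ)` on `v`.
    refine ⟨h, Ad (φ.toFun m)⁻¹ ξ, hh, (mem_isotropyAlg_iff hπ _).2 ?_, by rw [Ad_comp_Ad_inv]⟩
    rw [← φ.comp_form_gen μ hι hm, Ad_comp_Ad_inv]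
    simpa [hh] using h0

/-- The left trivialized derivative of the adaptor, as a map between the model spaces. -/
def modelLeftDeriv (m : M) : E →L[ℝ] EG := φ.leftDeriv m

/-- Factor `φ(x) = φ(m) · (φ(m)⁻¹ φ(x))`. The second factor is `1` at `m`, so only the derivative of
`Ad` at the unit enters. -/
theorem hasFDerivAt_Ad_toFun {m : M} (hm : m ∈ φ.domain) (η : EG) :
    HasFDerivAt (fun y => Ad (EG := EG) (φ.toFun ((extChartAt 𝓘(ℝ, E) m).symm y)) η)
      ((Ad (φ.toFun m)).comp ((ContinuousLinearMap.flip (ad EG G) η).comp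
        (φ.modelLeftDeriv m))) (extChartAt 𝓘(ℝ, E) m m) := by
  have hφ : MDifferentiableAt 𝓘(ℝ, E) 𝓘(ℝ, EG) (fun x : M => (φ.toFun m)⁻¹ * φ.toFun x) m :=
    (contMDiffAt_const.mul
      (φ.smooth.contMDiffAt (φ.isOpen_domain.mem_nhds hm))).mdifferentiableAt (by simp)
  have h1 := ((hasFDerivAt_comp_of_eq_one (hasFDerivAt_Ad (EG := EG) G) hφ (by simp)).clm_apply
    (hasFDerivAt_const η _))
  have h2 := (Ad (EG := EG) (φ.toFun m)).hasFDerivAt.comp _ h1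
  refine (h2.congr_fderiv ?_).congr_of_eventuallyEq (.of_forall fun y => ?_)
  · ext v
    simp
    rfl
  · simp only [Function.comp_apply]
    rw [← ContinuousLinearMap.comp_apply, ← Ad_mul, mul_inv_cancel_left]

theorem exists_hasFDerivAt_coord (hι : φ.IsRestrictedPseudoInverse μ π ι) {m : M}
    (hm : m ∈ φ.domain) :
    ∃ J : E →L[ℝ] (EG →L[ℝ] ℝ) →L[ℝ] EG,
      HasFDerivAt (fun y => ι ((extChartAt 𝓘(ℝ, E) m).symm y)) J (extChartAt 𝓘(ℝ, E) m m) := by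
  have h1 := hι.differentiable.mdifferentiableAt (φ.isOpen_domain.mem_nhds hm)
  rw [← extChartAt_to_inv (I := 𝓘(ℝ, E)) m] at h1
  exact ⟨_, (MDifferentiableAt.comp _ h1 (mdifferentiableAt_chart_symm
    (mem_extChartAt_target m))).differentiableAt.hasFDerivAt⟩

/-- The derivative of the identity `π (ι (μ Z)) = 0` for an almost horizontal vector field `Z`. -/
theorem deriv_comp_form_field [CompleteSpace E] (hπ : IsIsotropyProjection E G m₀ π)
    (hι : φ.IsRestrictedPseudoInverse μ π ι) {m : M}
    {J : E →L[ℝ] (EG →L[ℝ] ℝ) →L[ℝ] EG} {N : E →L[ℝ] E →L[ℝ] EG →L[ℝ] ℝ}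
    (hJ : HasFDerivAt (fun y => ι ((extChartAt 𝓘(ℝ, E) m).symm y)) J (extChartAt 𝓘(ℝ, E) m m))
    (hN : HasFDerivAt (coordForm μ.toForm m) N (extChartAt 𝓘(ℝ, E) m m))
    {W : Set M} (hW : IsOpen W) (hmW : m ∈ W) (hWd : W ⊆ φ.domain)
    {Z : ∀ x : M, TangentSpace 𝓘(ℝ, E) x}
    (hZ : IsSmoothSection (φ.almostHorizontal μ) Z W) (z v : E) (hz : z = Z m) :
    π (J v (μ.form m z)) + π (ι m (N v z))
      + π (ι m (μ.form m (fderiv ℝ (coordField Z m) (extChartAt 𝓘(ℝ, E) m m) v))) = 0 := by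
  have hZ' := (differentiableAt_coordField ((hZ.smooth.contMDiffAt
    (hW.mem_nhds hmW)).mdifferentiableAt (by simp))).hasFDerivAt
  have hl := hasFDerivAt_comp_of_eq π.hasFDerivAt (hJ.clm_apply (hN.clm_apply hZ')) rfl
  have he := hl.unique ((hasFDerivAt_const (0 : EG) _).congr_of_eventuallyEq ?_)
  · have h3 := DFunLike.congr_fun he v
    have hz' : coordField Z m (extChartAt 𝓘(ℝ, E) m m) = z := (coordField_self Z m).trans hz.symm
    simp only [extChartAt_to_inv, μ.coordForm_eq_form, hz', add_apply,
      ContinuousLinearMap.comp_apply, ContinuousLinearMap.flip_apply, zero_apply, map_add] at h3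
    rw [← h3]
    abel
  · filter_upwards [(tendsto_chart_symm m).eventually (hW.mem_nhds hmW),
      eventually_mem_chart_target (E := E) m] with y hy hyt
    have h4 := (φ.mem_almostHorizontal_iff μ hπ hι (hWd hy) _).1 (hZ.mem _ hy)
    exact (congrArg (fun w => π (ι _ w)) (μ.coordForm_chart hyt _)).trans h4

/-- The derivative of the identity `π (ι (μ (Ad_φ η)_M)) = π η` along an almost horizontal
vector. -/
theorem deriv_comp_form_gen (hπ : IsIsotropyProjection E G m₀ π)
    (hι : φ.IsRestrictedPseudoInverse μ π ι) {m : M} (hm : m ∈ φ.domain)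
    (hb : φ.BracketCondition μ m)
    {J : E →L[ℝ] (EG →L[ℝ] ℝ) →L[ℝ] EG} {N : E →L[ℝ] E →L[ℝ] EG →L[ℝ] ℝ}
    {L : EG →L[ℝ] E →L[ℝ] E}
    (hJ : HasFDerivAt (fun y => ι ((extChartAt 𝓘(ℝ, E) m).symm y)) J (extChartAt 𝓘(ℝ, E) m m))
    (hN : HasFDerivAt (coordForm μ.toForm m) N (extChartAt 𝓘(ℝ, E) m m))
    (hL : HasFDerivAt (coordGen (EG := EG) G m) L.flip (extChartAt 𝓘(ℝ, E) m m))
    {v : E} (hv : (v : TangentSpace 𝓘(ℝ, E) m) ∈ φ.almostHorizontal μ m) {η : EG}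
    (hη : η ∈ isotropyAlg (EG := EG) E G m₀) :
    π (J v (μ.form m (gen E EG G m (Ad (φ.toFun m) η))))
      + π (ι m (N v (gen E EG G m (Ad (φ.toFun m) η))))
      + π (ι m (μ.form m (L (Ad (φ.toFun m) η) v))) = 0 := by
  have hl := hasFDerivAt_comp_of_eq π.hasFDerivAt (hJ.clm_apply (hN.clm_apply
    (hL.clm_apply (φ.hasFDerivAt_Ad_toFun hm η)))) rfl
  have he := hl.unique ((hasFDerivAt_const (π η) _).congr_of_eventuallyEq ?_)
  · have h3 := DFunLike.congr_fun he v
    -- The derivative of `φ` contributes `π ι χ_φ [d^L φ(v), η] = π [d^L φ(v), η]`, which condition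
    -- (*) kills.
    have h5 : π (ad EG G (φ.modelLeftDeriv m v) η) = 0 := by
      rw [← mem_isotropyAlg_iff hπ, ← lieBracket_eq_ad]
      exact hb v hv η hη
    rw [← φ.comp_form_gen μ hι hm] at h5
    simp only [extChartAt_to_inv, μ.coordForm_eq_form, coordGen_self, add_apply,
      ContinuousLinearMap.comp_apply, ContinuousLinearMap.flip_apply, zero_apply, map_add, h5] at h3
    rw [← h3]
    abel
  · filter_upwards [(tendsto_chart_symm m).eventually (φ.isOpen_domain.mem_nhds hm),
      eventually_mem_chart_target (E := E) m] with y hy hyt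
    have h4 := φ.comp_form_gen μ hι hy η
    exact (congrArg (fun w => π (ι _ w)) (μ.coordForm_chart hyt _)).trans h4

theorem curvature_add_mlieBracket_mem [CompleteSpace E] (hπ : IsIsotropyProjection E G m₀ π)
    (hι : φ.IsRestrictedPseudoInverse μ π ι) {m : M} (hm : m ∈ φ.domain) (hd : μ.DocileAt m)
    (hb : φ.BracketCondition μ m) {W : Set M} (hW : IsOpen W) (hmW : m ∈ W) (hWd : W ⊆ φ.domain)
    {X Y : ∀ x : M, TangentSpace 𝓘(ℝ, E) x}
    (hX : IsSmoothSection (φ.almostHorizontal μ) X W)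
    (hY : IsSmoothSection (φ.almostHorizontal μ) Y W) :
    μ.curvature m (X m) (Y m) + VectorField.mlieBracket 𝓘(ℝ, E) X Y m
      ∈ φ.almostHorizontal μ m := by
  obtain ⟨L, hL1, hL2⟩ := exists_mixed_smul (EG := EG) (E := E) G m
  obtain ⟨N, hN⟩ := μ.exists_hasFDerivAt_coordForm m
  obtain ⟨J, hJ⟩ := φ.exists_hasFDerivAt_coord μ hι hm
  -- Tangent vectors at `m` are renamed as vectors of `E`, so that all the arithmetic takes place in
  -- the model space.
  obtain ⟨x, hx⟩ : ∃ x : E, x = X m := ⟨_, rfl⟩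
  obtain ⟨y, hy⟩ : ∃ y : E, y = Y m := ⟨_, rfl⟩
  have hxm : (x : TangentSpace 𝓘(ℝ, E) m) ∈ φ.almostHorizontal μ m := by
    rw [hx]
    exact hX.mem m hmW
  have hym : (y : TangentSpace 𝓘(ℝ, E) m) ∈ φ.almostHorizontal μ m := by
    rw [hy]
    exact hY.mem m hmW
  obtain ⟨b, hbr⟩ : ∃ b : E, b = VectorField.mlieBracket 𝓘(ℝ, E) X Y m := ⟨_, rfl⟩
  obtain ⟨c, hc⟩ : ∃ c : E, c = μ.curvature m x y := ⟨_, rfl⟩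
  have hbr' : b = fderiv ℝ (coordField Y m) (extChartAt 𝓘(ℝ, E) m m) x -
      fderiv ℝ (coordField X m) (extChartAt 𝓘(ℝ, E) m m) y := by
    rw [hbr, hx, hy]
    exact mlieBracket_eq X Y m
  have f1 := φ.deriv_comp_form_field μ hπ hι hJ hN hW hmW hWd hX x y hx
  have f2 := φ.deriv_comp_form_field μ hπ hι hJ hN hW hmW hWd hY y x hy
  obtain ⟨h, ζ, hh, hζ, hxd⟩ := (φ.mem_almostHorizontal_iff_exists μ m x).1 hxm
  obtain ⟨k, η, hk, hη, hyd⟩ := (φ.mem_almostHorizontal_iff_exists μ m y).1 hym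
  have i1 := φ.deriv_comp_form_gen μ hπ hι hm hb hJ hN hL2 hxm hη
  have i2 := φ.deriv_comp_form_gen μ hπ hι hm hb hJ hN hL2 hym hζ
  have had : ad EG G ζ η ∈ isotropyAlg (EG := EG) E G m₀ := ad_mem_isotropyAlg hζ hη
  rw [mem_isotropyAlg_iff hπ, ← φ.comp_form_gen μ hι hm, ← ad_Ad, gen_ad G hL1 hL2] at had
  have hK1 := congrArg (fun w => π (ι m w)) (μ.fderiv_coordForm_gen hL1 hN hk (Ad (φ.toFun m) ζ))
  have hK2 := congrArg (fun w => π (ι m w)) (μ.fderiv_coordForm_gen hL1 hN hh (Ad (φ.toFun m) η))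
  have hcv : μ.form m c = N h k - N k h := by
    rw [hc, hxd, hyd]
    exact μ.form_curvature hd hN hh hk _ _
  have hmem : π (ι m (μ.form m (c + b))) = 0 := by
    rw [map_add (μ.form m), hcv, hbr']
    clear hX hY hxm hym hx hy hbr hc hbr'
    subst hxd hyd
    simp only [map_add, map_sub, add_apply, hh, hk, map_zero, zero_add] at hK1 hK2 i1 i2 f1 f2 had ⊢
    -- `f2 - f1` produces the bracket; `i1`, `i2` cancel the terms in `J`, since `μ(x)` and `μ(y)`
    -- see only vertical parts; `hK1`, `hK2` cancel `N` on mixed pairs; `had` cancels the vertical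
    -- terms in `L`. The rest is the curvature term `N h k - N k h`.
    linear_combination (norm := abel) f2 - f1 - i1 + i2 - hK1 + hK2 - had
  have hfin := (φ.mem_almostHorizontal_iff μ hπ hι hm (c + b)).2 hmem
  subst hc hbr hx hy
  exact hfin

end Adaptor

end Main

end PartialConn

end

theorem mainTheorem2
    {E : Type*} [NormedAddCommGroup E] [NormedSpace ℝ E] [CompleteSpace E]
    {EG : Type*} [NormedAddCommGroup EG] [NormedSpace ℝ EG] [CompleteSpace EG]
    {G : Type*} [TopologicalSpace G] [ChartedSpace EG G] [Group G] [LieGroup 𝓘(ℝ, EG) ∞ G]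
    {M : Type*} [TopologicalSpace M] [ChartedSpace E M] [IsManifold 𝓘(ℝ, E) ∞ M]
    [MulAction G M] [ContMDiffSMul 𝓘(ℝ, EG) 𝓘(ℝ, E) ∞ G M]
    (μ : PartialConn.DualConnectionForm E EG G M) (m₀ : M)
    (φ : PartialConn.Adaptor E EG G m₀)
    (π : EG →L[ℝ] EG) (hπ : PartialConn.IsIsotropyProjection E G m₀ π)
    (ι : M → (EG →L[ℝ] ℝ) →L[ℝ] EG) (hι : φ.IsRestrictedPseudoInverse μ π ι) :
    (∀ m ∈ φ.domain, μ.DocileAt m → φ.BracketCondition μ m →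
      ∀ W : Set M, IsOpen W → m ∈ W → W ⊆ φ.domain →
      ∀ X Y : (∀ x : M, TangentSpace 𝓘(ℝ, E) x),
        PartialConn.IsSmoothSection (φ.almostHorizontal μ) X W →
        PartialConn.IsSmoothSection (φ.almostHorizontal μ) Y W →
        μ.curvature m (X m) (Y m) + VectorField.mlieBracket 𝓘(ℝ, E) X Y m
          ∈ φ.almostHorizontal μ m) ∧
    (∀ V : Set M, IsOpen V → m₀ ∈ V → V ⊆ φ.domain →
      (∀ m ∈ V, μ.DocileAt m) →
      (∀ m ∈ V, φ.BracketCondition μ m) →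
      (∀ m ∈ V, ∀ u v : TangentSpace 𝓘(ℝ, E) m, μ.curvature m u v ∈ φ.almostHorizontal μ m) →
      PartialConn.InvolutiveOn (φ.almostHorizontal μ) V) := by
  refine ⟨fun m hm hd hb W hW hmW hWd X Y hX hY =>
    φ.curvature_add_mlieBracket_mem μ hπ hι hm hd hb hW hmW hWd hX hY,
    fun V hV hm₀ hVd hdoc hbr hcurv W hW hWV X Y hX hY m hm => ?_⟩
  have h := φ.curvature_add_mlieBracket_mem μ hπ hι (hVd (hWV hm)) (hdoc m (hWV hm))
    (hbr m (hWV hm)) hW hm (hWV.trans hVd) hX hY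
  exact (Submodule.add_mem_iff_right _ (hcurv m (hWV hm) _ _)).1 h
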